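/- All near-rings are right near-rings: $(N,+)$ is a (not necessarily abelian) group with neutral element $0$, $(N,*)$ is a semigroup, and $(a+b)*c=a*c+b*c$ for all $a,b,c\in N$. A near-ring is a ring if addition is commutative and $a*(b+c)=a*b+a*c$ also holds. A near-field is a near-ring with identity $\neq 0$ in which every non-zero element is invertible. An a-near-ring is a near-ring $N$ with identity $1$ and $0*n=n*0=0$ for all $n$, such that $U\cup\{0\}$, where $U$ is the set of multiplicatively invertible elements, is a sub-near-ring which is a near-field. An ideal of $N$ is a normal subgroup $I$ of $(N,+)$ with $i*n\in I$ and $n*(n'+i)-n*n'\in I$ for all $i\in I$, $n,n'\in N$; $N$ is simple if $N\ne\{0\}$ and its only ideals are $\{0\}$ and $N$. DCCN is the descending chain condition on the subgroups $M$ of $(N,+)$ with $n*m\in M$ for all $n\in N$, $m\in M$. For a group $\Gamma$, $M_0(\Gamma)$ is the near-ring of all maps $f:\Gamma\to\Gamma$ with $f(0)=0$, under pointwise addition and composition. Theorem. Let $N$ be a simple a-near-ring with DCCN, and let $U$ be its set of units. (1) If $N$ is a ring and $|U|=1$, then $N$ is isomorphic to a direct product $\mathbb{Z}_2^k$ of $k$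 copies of the field $\mathbb{Z}_2$, for some integer $k\ge 1$. (2) If $N$ is a ring and $|U|\ge 2$, then $N$ is a (not necessarily commutative) field, i.e. a division ring. (3) If $N$ is not a ring, then $N$ is a near-field or $N\cong M_0(\mathbb{Z}_3)$. -/

import Mathlib

universe u

/-- A (right) near-ring: a group `(N, +)`, not necessarily abelian, and a semigroup `(N, *)`
with the right distributive law `(a + b) * c = a * c + b * c`. -/
class NearRing (N : Type u) extends AddGroup N, Semigroup N where
  right_distrib : ∀ a b c : N, (a + b) * c = a * c + b * c

/-- A zero-symmetric near-ring with identity: a near-ring with `0 * n = n * 0 = 0` and a two-sided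
multiplicative identity `1` (these laws are the fields of `MonoidWithZero`). -/
class ZeroSymmNearRing (N : Type u) extends NearRing N, MonoidWithZero N

namespace NearRing

/-- A near-ring is a ring if its addition is commutative and left distributivity holds too. -/
def IsRing (N : Type u) [NearRing N] : Prop :=
  (∀ a b : N, a + b = b + a) ∧ ∀ a b c : N, a * (b + c) = a * b + a * c

/-- A near-field: the non-zero elements are all invertible with respect to an identity
`e ≠ 0`. (As `0 * b = 0`, the element `0` is not invertible, so the non-zero elements are exactly
the units and form a group.) -/
def IsNearField (N : Type u) [NearRing N] : Prop :=
  ∃ e : N, e ≠ 0 ∧ (∀ a : N, e * a = a ∧ a * e = a) ∧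
    ∀ a : N, a ≠ 0 → ∃ b : N, a * b = e ∧ b * a = e

/-- The near-ring `N` is a (not necessarily commutative) division ring. -/
def IsDivisionRing (N : Type u) [NearRing N] : Prop :=
  ∃ (D : Type u) (_ : DivisionRing D), Nonempty (N ≃+* D)

/-- `M ≤ (N, +)` is an `N`-subgroup if `N * M ⊆ M`. -/
def IsNSubgroup {N : Type u} [NearRing N] (M : AddSubgroup N) : Prop :=
  ∀ n : N, ∀ m ∈ M, n * m ∈ M

/-- The descending chain condition for `N`-subgroups of `N`. -/
def DCCN (N : Type u) [NearRing N] : Prop :=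
  WellFoundedLT {M : AddSubgroup N // IsNSubgroup M}

/-- An ideal of a right near-ring: a normal subgroup `I` of `(N, +)` with `I * N ⊆ I` and
`n * (n' + i) - n * n' ∈ I` for all `n, n' ∈ N` and `i ∈ I`. -/
structure IsIdeal {N : Type u} [NearRing N] (I : AddSubgroup N) : Prop where
  normal : I.Normal
  mul_mem_right : ∀ i ∈ I, ∀ n : N, i * n ∈ I
  mul_add_sub_mem : ∀ n n' : N, ∀ i ∈ I, n * (n' + i) - n * n' ∈ I

/-- A near-ring is simple if it is non-zero and its only ideals are `{0}` and itself. -/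
def IsSimple (N : Type u) [NearRing N] : Prop :=
  Nontrivial N ∧ ∀ I : AddSubgroup N, IsIdeal I → I = ⊥ ∨ I = ⊤

/-- A sub-near-ring: an additive subgroup closed under multiplication. -/
structure SubNearRing (N : Type u) [NearRing N] extends AddSubgroup N where
  mul_mem' : ∀ {a b : N}, a ∈ carrier → b ∈ carrier → a * b ∈ carrier

/-- A sub-near-ring is a near-ring with respect to the near-ring operations of `N`. -/
instance SubNearRing.instNearRing {N : Type u} [NearRing N] (S : SubNearRing N) :
    NearRing S.toAddSubgroup where
  mul a b := ⟨a.1 * b.1, S.mul_mem' a.2 b.2⟩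
  mul_assoc a b c := Subtype.ext (mul_assoc a.1 b.1 c.1)
  right_distrib a b c := Subtype.ext (NearRing.right_distrib a.1 b.1 c.1)

/-- An a-near-ring: a zero-symmetric near-ring with identity such that the set `U ∪ {0}`, with `U`
the set of units, is a sub-near-ring which is a near-field. -/
def IsANearRing (N : Type u) [ZeroSymmNearRing N] : Prop :=
  ∃ S : SubNearRing N, (S.carrier = {n : N | IsUnit n} ∪ {0}) ∧ IsNearField S.toAddSubgroup

/-- The set `M₀(Γ)` of all maps `Γ → Γ` that fix `0`. -/
@[ext] structure M0 (Γ : Type u) [AddGroup Γ] where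
  val : Γ → Γ
  property : val 0 = 0

namespace M0

variable {Γ : Type u} [AddGroup Γ]

instance : Zero (M0 Γ) := ⟨⟨fun _ => 0, rfl⟩⟩

instance : One (M0 Γ) := ⟨⟨fun x => x, rfl⟩⟩

instance : Add (M0 Γ) := ⟨fun f g => ⟨fun x => f.val x + g.val x, by simp [f.property, g.property]⟩⟩

instance : Neg (M0 Γ) := ⟨fun f => ⟨fun x => -f.val x, by simp [f.property]⟩⟩

instance : Mul (M0 Γ) := ⟨fun f g => ⟨fun x => f.val (g.val x), by simp [f.property, g.property]⟩⟩

/-- `M₀(Γ)` is a near-ring under pointwise addition and composition. -/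
instance : ZeroSymmNearRing (M0 Γ) where
  add_assoc f g h := M0.ext (funext fun x => add_assoc (f.val x) (g.val x) (h.val x))
  zero_add f := M0.ext (funext fun x => zero_add (f.val x))
  add_zero f := M0.ext (funext fun x => add_zero (f.val x))
  neg_add_cancel f := M0.ext (funext fun x => neg_add_cancel (f.val x))
  mul_assoc _ _ _ := rfl
  one_mul _ := rfl
  mul_one _ := rfl
  zero_mul _ := rfl
  mul_zero f := M0.ext (funext fun _ => f.property)
  right_distrib _ _ _ := rfl
  nsmul := nsmulRec
  zsmul := zsmulRec

end M0

end NearRing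

/-! A minimal non-zero `N`-subgroup `L` exists by DCCN, and simplicity makes it faithful because its
annihilator is an ideal. The a-near-ring condition enters through rigidity: a unit `u` fixing some
`x ≠ 0` is `1`, since `u - 1` is a unit or `0` and kills `x` (`IsANearRing.eq_one_of_mul_eq`). In
the ring case, `x * x = 0` makes `1 + x` a unit fixing `x`, so `N` is reduced; then non-zero
elements of `L` have zero annihilator, and minimality of `L` yields inverses. Part (1) is thus the
case `k = 1`. Otherwise, by `density` and DCCN, `N` can prescribe a value at one point of `L` while
killing all points with a different annihilator. With one annihilator class `N` is a near-field.
With more, rigidity forbids units that move some points and fix another, which forces `L` to have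
order 3 and `N` to act by all zero-fixing maps. -/

namespace NearRing

/-! ### Annihilators and the faithful minimal `N`-subgroup -/

section Basic

variable {N : Type u} [ZeroSymmNearRing N]

theorem add_mul' (a b c : N) : (a + b) * c = a * c + b * c := NearRing.right_distrib a b c

theorem neg_mul' (a c : N) : -a * c = -(a * c) := by
  apply eq_neg_of_add_eq_zero_left
  rw [← add_mul', neg_add_cancel, zero_mul]

theorem sub_mul' (a b c : N) : (a - b) * c = a * c - b * c := by
  rw [sub_eq_add_neg, add_mul', neg_mul', ← sub_eq_add_neg]

/-- The annihilator `{n | n * x = 0 for all x ∈ F}` of a set `F`. -/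
def annihilator (F : Set N) : AddSubgroup N where
  carrier := {n | ∀ x ∈ F, n * x = 0}
  zero_mem' := fun x _ => zero_mul x
  add_mem' := fun ha hb x hx => by rw [add_mul', ha x hx, hb x hx, add_zero]
  neg_mem' := fun ha x hx => by rw [neg_mul', ha x hx, neg_zero]

theorem mem_annihilator {F : Set N} {n : N} : n ∈ annihilator F ↔ ∀ x ∈ F, n * x = 0 := Iff.rfl

theorem annihilator_isNSubgroup (F : Set N) : IsNSubgroup (annihilator F) := fun n m hm x hx => by
  rw [mul_assoc, hm x hx, mul_zero]

/-- The annihilator of an `N`-subgroup is an ideal. -/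
theorem annihilator_isIdeal {L : AddSubgroup N} (hL : IsNSubgroup L) :
    IsIdeal (annihilator (L : Set N)) where
  normal := ⟨fun i hi n x hx => by
    rw [add_mul', add_mul', neg_mul', hi x hx, add_zero, add_neg_cancel]⟩
  mul_mem_right i hi n x hx := by rw [mul_assoc]; exact hi _ (hL n x hx)
  mul_add_sub_mem n n' i hi x hx := by
    rw [sub_mul', mul_assoc, add_mul', hi x hx, add_zero, mul_assoc, sub_self]

/-- The image of an additive subgroup under right multiplication by `x`. -/
def mulRightImage (C : AddSubgroup N) (x : N) : AddSubgroup N where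
  carrier := {y | ∃ c ∈ C, c * x = y}
  zero_mem' := ⟨0, C.zero_mem, zero_mul x⟩
  add_mem' := by
    rintro _ _ ⟨a, ha, rfl⟩ ⟨b, hb, rfl⟩
    exact ⟨a + b, C.add_mem ha hb, add_mul' a b x⟩
  neg_mem' := by
    rintro _ ⟨a, ha, rfl⟩
    exact ⟨-a, C.neg_mem ha, neg_mul' a x⟩

/-- `L` is a minimal non-zero `N`-subgroup which is a faithful `N`-group. -/
structure IsFaithfulMinimal (L : AddSubgroup N) : Prop where
  isNSubgroup : IsNSubgroup L
  ne_bot : L ≠ ⊥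
  eq_of_le : ∀ M : AddSubgroup N, IsNSubgroup M → M ≤ L → M ≠ ⊥ → M = L
  faithful : ∀ n : N, (∀ x ∈ L, n * x = 0) → n = 0

theorem exists_isFaithfulMinimal (hs : IsSimple N) (hd : DCCN N) :
    ∃ L : AddSubgroup N, IsFaithfulMinimal L := by
  obtain ⟨hnt, hsimple⟩ := hs
  have hwf : WellFounded ((· < ·) :
      {M : AddSubgroup N // IsNSubgroup M} → {M : AddSubgroup N // IsNSubgroup M} → Prop) := hd.wf
  obtain ⟨⟨L, hL⟩, hne, hmin⟩ := hwf.has_min {M | M.1 ≠ ⊥}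
    ⟨⟨⊤, fun _ _ _ => AddSubgroup.mem_top _⟩, top_ne_bot⟩
  refine ⟨L, hL, hne, fun M hM hle hMne => ?_, fun n hn => ?_⟩
  · by_contra h
    exact hmin ⟨M, hM⟩ hMne (lt_of_le_of_ne hle h : M < L)
  -- The annihilator of `L` is not all of `N`, because `1` does not kill `L ≠ 0`.
  · rcases hsimple _ (annihilator_isIdeal hL) with h | h
    · have : n ∈ annihilator (L : Set N) := hn
      rw [h] at this
      exact AddSubgroup.mem_bot.mp this
    · refine (hne ((AddSubgroup.eq_bot_iff_forall _).2 fun x hx => ?_)).elim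
      have : (1 : N) ∈ annihilator (L : Set N) := h ▸ AddSubgroup.mem_top _
      simpa using this x hx

theorem isUnit_of_forall_exists_left_inv (h : ∀ a : N, a ≠ 0 → ∃ b : N, b * a = 1)
    (hnt : Nontrivial N) {a : N} (ha : a ≠ 0) : ∃ b : N, a * b = 1 ∧ b * a = 1 := by
  have h01 : (1 : N) ≠ 0 := one_ne_zero
  obtain ⟨b, hb⟩ := h a ha
  have hb0 : b ≠ 0 := by rintro rfl; exact h01 (by rw [← hb, zero_mul])
  obtain ⟨c, hc⟩ := h b hb0
  have hca : c = a := by rw [← mul_one c, ← hb, ← mul_assoc, hc, one_mul]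
  exact ⟨b, hca ▸ hc, hb⟩

end Basic

/-! ### Density of the action on `L` -/

namespace IsFaithfulMinimal

variable {N : Type u} [ZeroSymmNearRing N] {L : AddSubgroup N}

theorem exists_ne_zero (h : IsFaithfulMinimal L) : ∃ x ∈ L, x ≠ 0 := by
  by_contra! hx
  exact h.ne_bot ((AddSubgroup.eq_bot_iff_forall _).2 hx)

theorem ext (h : IsFaithfulMinimal L) {a b : N} (hab : ∀ x ∈ L, a * x = b * x) : a = b :=
  sub_eq_zero.1 (h.faithful _ fun x hx => by rw [sub_mul', hab x hx, sub_self])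

/-- `C * x` is a non-zero `N`-subgroup inside `L`, so minimality makes it all of `L`. -/
theorem exists_mul_eq (h : IsFaithfulMinimal L) {C : AddSubgroup N} (hC : IsNSubgroup C)
    {x : N} (hx : x ∈ L) (hne : ∃ c ∈ C, c * x ≠ 0) {z : N} (hz : z ∈ L) :
    ∃ c ∈ C, c * x = z := by
  have key : mulRightImage C x = L := by
    refine h.eq_of_le _ ?_ ?_ ?_
    · rintro n _ ⟨c, hc, rfl⟩
      exact ⟨n * c, hC n c hc, mul_assoc n c x⟩
    · rintro _ ⟨c, -, rfl⟩
      exact h.isNSubgroup c x hx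
    · obtain ⟨c, hc, hcx⟩ := hne
      intro hb
      have : c * x ∈ mulRightImage C x := ⟨c, hc, rfl⟩
      rw [hb] at this
      exact hcx (AddSubgroup.mem_bot.mp this)
  rw [← key] at hz
  exact hz

theorem exists_mul_eq_of_ne_zero (h : IsFaithfulMinimal L) {x : N} (hx : x ∈ L) (hx0 : x ≠ 0)
    {z : N} (hz : z ∈ L) : ∃ c : N, c * x = z := by
  obtain ⟨c, -, hc⟩ := h.exists_mul_eq (C := ⊤) (fun _ _ _ => AddSubgroup.mem_top _) hx
    ⟨1, AddSubgroup.mem_top _, by rwa [one_mul]⟩ hz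
  exact ⟨c, hc⟩

/-- Annihilators of non-zero elements of `L` are maximal among each other. -/
theorem annihilator_le (h : IsFaithfulMinimal L) {x y : N} (hx : x ∈ L) (hy0 : y ≠ 0)
    (hxy : ∀ n : N, n * x = 0 → n * y = 0) (n : N) (hn : n * y = 0) : n * x = 0 := by
  by_contra hnx
  -- With `m * n * x = x`, the element `1 - m * n` kills `x`, hence `y`; but `n * y = 0` then gives
  -- `y = 0`.
  obtain ⟨m, hm⟩ := h.exists_mul_eq_of_ne_zero (h.isNSubgroup n x hx) hnx hx
  have h1 := hxy (1 - m * n) (by rw [sub_mul', one_mul, mul_assoc, hm, sub_self])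
  rw [sub_mul', one_mul, mul_assoc, hn, mul_zero, sub_zero] at h1
  exact hy0 h1

/-- Two elements have the same annihilator. -/
def SameAnn (x y : N) : Prop := ∀ n : N, n * x = 0 ↔ n * y = 0

/-- The swapped summands make `n = 1` give commutativity of `L`; faithfulness transfers both laws to
`N`. -/
theorem isRing_of_mul_add (h : IsFaithfulMinimal L)
    (hadd : ∀ n : N, ∀ x ∈ L, ∀ z ∈ L, n * (x + z) = n * z + n * x) : IsRing N := by
  have hcomm : ∀ x ∈ L, ∀ z ∈ L, x + z = z + x := fun x hx z hz => by
    simpa using hadd 1 x hx z hz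
  refine ⟨fun a b => h.ext fun x hx => ?_, fun a b c => h.ext fun x hx => ?_⟩
  · rw [add_mul', add_mul']
    exact hcomm _ (h.isNSubgroup a x hx) _ (h.isNSubgroup b x hx)
  · rw [mul_assoc, add_mul', add_mul', mul_assoc, mul_assoc,
      hadd a _ (h.isNSubgroup b x hx) _ (h.isNSubgroup c x hx)]
    exact hcomm _ (h.isNSubgroup a _ (h.isNSubgroup c x hx)) _
      (h.isNSubgroup a _ (h.isNSubgroup b x hx))

/-- The density theorem for a near-ring which is not a ring. -/
theorem density (h : IsFaithfulMinimal L) (hring : ¬ IsRing N) (F : Finset N) :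
    (∀ x ∈ F, x ∈ L ∧ x ≠ 0) → ∀ y ∈ L, y ≠ 0 → (∀ x ∈ F, ¬ SameAnn x y) →
      ∃ b ∈ annihilator (F : Set N), b * y ≠ 0 := by
  classical
  induction F using Finset.induction_on with
  | empty => exact fun _ y _ hy0 _ => ⟨1, by simp [mem_annihilator], by rwa [one_mul]⟩
  | insert g F _ ih =>
    intro hF y hy hy0 hsame
    have hF' : ∀ x ∈ F, x ∈ L ∧ x ≠ 0 := fun x hx => hF x (Finset.mem_insert_of_mem hx)
    obtain ⟨hg, hg0⟩ := hF g (Finset.mem_insert_self _ _)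
    have hins : ∀ b ∈ annihilator (F : Set N), b * g = 0 →
        b ∈ annihilator ((insert g F : Finset N) : Set N) := by
      intro b hb hbg x hx
      rcases Finset.mem_insert.1 (Finset.mem_coe.1 hx) with rfl | hx
      · exact hbg
      · exact hb x hx
    have hy' := ih hF' y hy hy0 fun x hx => hsame x (Finset.mem_insert_of_mem hx)
    by_cases hgF : ∃ x ∈ F, SameAnn x g
    · obtain ⟨x, hx, hxg⟩ := hgF
      obtain ⟨b, hb, hby⟩ := hy'
      exact ⟨b, hins b hb ((hxg b).1 (hb x hx)), hby⟩
    · push Not at hgF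
      by_contra! hcon
      apply hring
      apply h.isRing_of_mul_add
      intro n x hx z hz
      obtain ⟨c, hc, rfl⟩ := h.exists_mul_eq (annihilator_isNSubgroup _) hy hy' hz
      have hsep : ∃ m ∈ annihilator ({g} : Set N), m * y ≠ 0 := by
        by_contra! hm
        have hle : ∀ n : N, n * g = 0 → n * y = 0 := fun n hn =>
          hm n (by simpa [mem_annihilator] using hn)
        exact hsame g (Finset.mem_insert_self _ _)
          fun n => ⟨hle n, h.annihilator_le hg hy0 hle n⟩
      obtain ⟨m, hm, rfl⟩ := h.exists_mul_eq (annihilator_isNSubgroup _) hy hsep hx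
      have hmg : m * g = 0 := hm g rfl
      -- This additivity defect vanishes on `F`, where `c` does, and at `g`, where `m` does. If it
      -- must also vanish at `y`, then `n` is additive at the arbitrary pair `m * y`, `c * y`.
      have hd := hcon (n * (m + c) - n * m - n * c) (hins _ ?_ ?_)
      · rw [sub_mul', sub_mul', mul_assoc, mul_assoc, mul_assoc, add_mul', sub_eq_zero,
          sub_eq_iff_eq_add] at hd
        exact hd
      · intro f hf
        rw [sub_mul', sub_mul', mul_assoc, mul_assoc, mul_assoc, add_mul', hc f hf, mul_zero,
          add_zero, sub_self, sub_zero]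
      · rw [sub_mul', sub_mul', mul_assoc, mul_assoc, mul_assoc, add_mul', hmg, zero_add, mul_zero,
          sub_zero, sub_self]

/-- Finitely many elements of `L` have a trivial common annihilator. -/
theorem exists_finset_annihilator_eq_zero (h : IsFaithfulMinimal L) (hd : DCCN N) :
    ∃ F : Finset N, (∀ x ∈ F, x ∈ L ∧ x ≠ 0) ∧ ∀ b ∈ annihilator (F : Set N), b = 0 := by
  classical
  have hwf : WellFounded ((· < ·) :
      {M : AddSubgroup N // IsNSubgroup M} → {M : AddSubgroup N // IsNSubgroup M} → Prop) := hd.wf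
  obtain ⟨B, ⟨F, hF, rfl⟩, hmin⟩ := hwf.has_min
    {B | ∃ F : Finset N, (∀ x ∈ F, x ∈ L ∧ x ≠ 0) ∧
      B = ⟨annihilator (F : Set N), annihilator_isNSubgroup _⟩} ⟨_, ∅, by simp, rfl⟩
  refine ⟨F, hF, fun b hb => h.faithful b fun x hx => ?_⟩
  by_contra hbx
  have hx0 : x ≠ 0 := by rintro rfl; exact hbx (mul_zero b)
  -- Adjoining `x` to `F` would strictly shrink a minimal annihilator.
  refine hmin ⟨annihilator ((insert x F : Finset N) : Set N), annihilator_isNSubgroup _⟩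
    ⟨insert x F, ?_, rfl⟩ ?_
  · intro y hy
    rcases Finset.mem_insert.1 hy with rfl | hy
    · exact ⟨hx, hx0⟩
    · exact hF y hy
  · refine lt_of_le_not_ge (fun c hc y hy => hc y ?_) fun hle => hbx (hle hb x ?_)
    · exact Finset.mem_coe.2 (Finset.mem_insert_of_mem hy)
    · exact Finset.mem_coe.2 (Finset.mem_insert_self x F)

/-- A finite `F` with zero annihilator meets every annihilator class, by density. Killing the
members of `F` outside the class of `x` therefore kills everything outside it. -/
theorem exists_mul_eq_and_mul_eq_zero (h : IsFaithfulMinimal L) (hring : ¬ IsRing N) (hd : DCCN N)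
    {x : N} (hx : x ∈ L) (hx0 : x ≠ 0) {z : N} (hz : z ∈ L) :
    ∃ b : N, b * x = z ∧ ∀ y ∈ L, ¬ SameAnn y x → b * y = 0 := by
  classical
  obtain ⟨F, hF, hF0⟩ := h.exists_finset_annihilator_eq_zero hd
  let F' := F.filter fun f => ¬ SameAnn f x
  obtain ⟨b, hb, rfl⟩ := h.exists_mul_eq (annihilator_isNSubgroup (F' : Set N)) hx
    (h.density hring F' (fun f hf => hF f (Finset.mem_filter.1 hf).1) x hx hx0
      fun f hf => (Finset.mem_filter.1 hf).2) hz
  refine ⟨b, rfl, fun y hy hyx => ?_⟩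
  rcases eq_or_ne y 0 with rfl | hy0
  · exact mul_zero b
  · have : ∃ f ∈ F, SameAnn f y := by
      by_contra! hcon
      obtain ⟨c, hc, hcy⟩ := h.density hring F hF y hy hy0 hcon
      exact hcy (by rw [hF0 c hc, zero_mul])
    obtain ⟨f, hf, hfy⟩ := this
    refine (hfy b).1 (hb f (Finset.mem_coe.2 (Finset.mem_filter.2 ⟨hf, fun hfx => hyx ?_⟩)))
    exact fun n => (hfy n).symm.trans (hfx n)

end IsFaithfulMinimal

/-! ### Rigidity of units and the ring case -/

section ANearRing

variable {N : Type u} [ZeroSymmNearRing N]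

theorem IsANearRing.isUnit_or_eq_zero_sub (ha : IsANearRing N) {a b : N} (hua : IsUnit a)
    (hub : IsUnit b) : IsUnit (a - b) ∨ a - b = 0 := by
  obtain ⟨S, hS, -⟩ := ha
  have hmem : ∀ x, x ∈ S.carrier ↔ IsUnit x ∨ x = 0 := fun x => by rw [hS]; rfl
  rw [sub_eq_add_neg]
  exact (hmem _).1
    (S.add_mem' ((hmem a).2 (Or.inl hua)) (S.neg_mem' ((hmem b).2 (Or.inl hub))))

/-- A unit of an a-near-ring with a non-zero fixed point is the identity. -/
theorem IsANearRing.eq_one_of_mul_eq (ha : IsANearRing N) {u x : N} (hu : IsUnit u)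
    (hx0 : x ≠ 0) (hux : u * x = x) : u = 1 := by
  rcases ha.isUnit_or_eq_zero_sub hu isUnit_one with h | h
  · refine (hx0 ?_).elim
    have h0 : (u - 1) * x = 0 := by rw [sub_mul', hux, one_mul, sub_self]
    obtain ⟨v, hv⟩ := h.exists_left_inv
    rw [← one_mul x, ← hv, mul_assoc, h0, mul_zero]
  · exact sub_eq_zero.1 h

/-- A near-ring which is a ring, as a bundled ring. -/
abbrev IsRing.toRing (hr : IsRing N) : Ring N :=
  { (inferInstance : ZeroSymmNearRing N) with
    add_comm := hr.1
    left_distrib := hr.2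
    right_distrib := add_mul' }

theorem IsANearRing.eq_zero_of_mul_self (ha : IsANearRing N) (hr : IsRing N) {x : N}
    (hx : x * x = 0) : x = 0 := by
  have h1 : (1 + x) * (1 - x) = 1 ∧ (1 - x) * (1 + x) = 1 := by
    let := hr.toRing
    have e1 : (1 + x) * (1 - x) = 1 - x * x := by noncomm_ring
    have e2 : (1 - x) * (1 + x) = 1 - x * x := by noncomm_ring
    rw [hx, sub_zero] at e1 e2
    exact ⟨e1, e2⟩
  have hu : IsUnit (1 + x) := ⟨⟨1 + x, 1 - x, h1.1, h1.2⟩, rfl⟩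
  by_contra hx0
  have := ha.eq_one_of_mul_eq hu hx0 (by rw [add_mul', hx, one_mul, add_zero])
  exact hx0 (by simpa using this)

/-- A simple a-near-ring with DCCN which is a ring is a division ring. -/
theorem IsANearRing.exists_inv_of_isRing (ha : IsANearRing N) (hs : IsSimple N) (hd : DCCN N)
    (hr : IsRing N) {a : N} (ha0 : a ≠ 0) : ∃ b : N, a * b = 1 ∧ b * a = 1 := by
  obtain ⟨L, h⟩ := exists_isFaithfulMinimal hs hd
  refine isUnit_of_forall_exists_left_inv (fun a ha0 => ?_) hs.1 ha0
  obtain ⟨l, hl, hl0⟩ := h.exists_ne_zero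
  have hinj : ∀ n : N, n * l = 0 → n = 0 := by
    intro n hn
    -- In a reduced ring `n * l = 0` gives `l * n = 0`, and then `n * (m * l)` has square zero for
    -- every `m`.
    have hln : l * n = 0 := ha.eq_zero_of_mul_self hr (by
      rw [mul_assoc, ← mul_assoc n, hn, zero_mul, mul_zero])
    refine h.faithful n fun x hx => ?_
    obtain ⟨m, rfl⟩ := h.exists_mul_eq_of_ne_zero hl hl0 hx
    refine ha.eq_zero_of_mul_self hr ?_
    rw [mul_assoc, mul_assoc m l, ← mul_assoc l n, hln, zero_mul, mul_zero, mul_zero]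
  obtain ⟨b, hb⟩ := h.exists_mul_eq_of_ne_zero (h.isNSubgroup a l hl)
    (fun h0 => ha0 (hinj a h0)) hl
  refine ⟨b, sub_eq_zero.1 (hinj _ ?_)⟩
  rw [sub_mul', mul_assoc, hb, one_mul, sub_self]

theorem isDivisionRing_of_exists_inv (hnt : Nontrivial N) (hr : IsRing N)
    (hinv : ∀ a : N, a ≠ 0 → ∃ b : N, a * b = 1 ∧ b * a = 1) : IsDivisionRing N := by
  let R := hr.toRing
  refine ⟨N, DivisionRing.ofIsUnitOrEqZero fun a => ?_, ⟨RingEquiv.refl N⟩⟩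
  rcases eq_or_ne a 0 with h | h
  · exact Or.inr h
  · obtain ⟨b, h1, h2⟩ := hinv a h
    exact Or.inl ⟨⟨a, b, h1, h2⟩, rfl⟩

open Classical in
theorem nonempty_ringEquiv_zmod_two (hnt : Nontrivial N) (h01 : ∀ a : N, a = 0 ∨ a = 1) :
    Nonempty (N ≃+* (Fin 1 → ZMod 2)) := by
  have h10 : (1 : N) ≠ 0 := one_ne_zero
  have h11 : (1 : N) + 1 = 0 := by
    rcases h01 (1 + 1) with h | h
    · exact h
    · exact (h10 (add_eq_left.1 h)).elim
  have hz : ∀ z : ZMod 2, z = 0 ∨ z = 1 := by decide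
  have hz11 : (0 : ZMod 2) = 1 + 1 := by decide
  exact ⟨{
    toFun := fun a _ => if a = 0 then 0 else 1
    invFun := fun z => if z 0 = 0 then 0 else 1
    left_inv := fun a => by rcases h01 a with rfl | rfl <;> simp [h10]
    right_inv := fun z => by
      funext i
      rw [Subsingleton.elim i 0]
      rcases hz (z 0) with h | h <;> simp [h]
    map_mul' := fun a b => by
      funext i
      rcases h01 a with rfl | rfl <;> rcases h01 b with rfl | rfl <;> simp [h10]
    map_add' := fun a b => by
      funext i
      rcases h01 a with rfl | rfl <;> rcases h01 b with rfl | rfl <;> simp [h10, h11, hz11] }⟩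

/-! ### The case where `N` is not a ring -/

open IsFaithfulMinimal

/-- If all non-zero elements of `L` have the same annihilator, then `N` is a near-field. -/
theorem IsFaithfulMinimal.isNearField {L : AddSubgroup N} (h : IsFaithfulMinimal L)
    (hnt : Nontrivial N) (hsame : ∀ x ∈ L, x ≠ 0 → ∀ y ∈ L, y ≠ 0 → SameAnn x y) :
    IsNearField N := by
  refine ⟨1, one_ne_zero, fun a => ⟨one_mul a, mul_one a⟩, fun a ha0 =>
    isUnit_of_forall_exists_left_inv (fun a ha0 => ?_) hnt ha0⟩
  obtain ⟨l, hl, hl0⟩ := h.exists_ne_zero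
  have hinj : ∀ n : N, n * l = 0 → n = 0 := by
    refine fun n hn => h.faithful n fun x hx => ?_
    rcases eq_or_ne x 0 with rfl | hx0
    · exact mul_zero n
    · exact (hsame l hl hl0 x hx hx0 n).1 hn
  obtain ⟨b, hb⟩ := h.exists_mul_eq_of_ne_zero (h.isNSubgroup a l hl)
    (fun h0 => ha0 (hinj a h0)) hl
  refine ⟨b, sub_eq_zero.1 (hinj _ ?_)⟩
  rw [sub_mul', mul_assoc, hb, one_mul, sub_self]

/-- If `N` is not a ring and has two different annihilators of non-zero elements of `L`, then
elements of `L` are determined by their annihilators. -/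
theorem IsANearRing.eq_of_sameAnn (ha : IsANearRing N) {L : AddSubgroup N}
    (h : IsFaithfulMinimal L) (hring : ¬ IsRing N) (hd : DCCN N)
    {x y : N} (hx : x ∈ L) (hx0 : x ≠ 0) (hy : y ∈ L) (hy0 : y ≠ 0) (hxy : SameAnn x y)
    {w : N} (hw : w ∈ L) (hw0 : w ≠ 0) (hwx : ¬ SameAnn w x) : x = y := by
  have hclass : ∀ z, SameAnn z x ↔ SameAnn z y := fun z =>
    ⟨fun hz n => (hz n).trans (hxy n), fun hz n => (hz n).trans (hxy n).symm⟩
  -- The value `-x + y` makes `1 + b` send `x` to `y` and fix everything outside the class; `1 + c`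
  -- is its inverse.
  obtain ⟨b, hb, hb0⟩ := h.exists_mul_eq_and_mul_eq_zero hring hd hx hx0
    (L.add_mem (L.neg_mem hx) hy)
  obtain ⟨c, hc, hc0⟩ := h.exists_mul_eq_and_mul_eq_zero hring hd hy hy0
    (L.add_mem (L.neg_mem hy) hx)
  have hux : (1 + b) * x = y := by rw [add_mul', hb, one_mul, add_neg_cancel_left]
  have hvy : (1 + c) * y = x := by rw [add_mul', hc, one_mul, add_neg_cancel_left]
  have hu : ∀ z ∈ L, ¬ SameAnn z x → (1 + b) * z = z := fun z hz hzx => by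
    rw [add_mul', hb0 z hz hzx, one_mul, add_zero]
  have hv : ∀ z ∈ L, ¬ SameAnn z x → (1 + c) * z = z := fun z hz hzx => by
    rw [add_mul', hc0 z hz fun hzy => hzx ((hclass z).2 hzy), one_mul, add_zero]
  have hvu : (1 + c) * (1 + b) = 1 := by
    refine sub_eq_zero.1 (h.faithful _ fun z hz => ?_)
    by_cases hzx : SameAnn z x
    · refine (hzx _).2 ?_
      rw [sub_mul', mul_assoc, hux, hvy, one_mul, sub_self]
    · rw [sub_mul', mul_assoc, hu z hz hzx, hv z hz hzx, one_mul, sub_self]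
  have huv : (1 + b) * (1 + c) = 1 := by
    refine sub_eq_zero.1 (h.faithful _ fun z hz => ?_)
    by_cases hzx : SameAnn z x
    · refine ((hclass z).1 hzx _).2 ?_
      rw [sub_mul', mul_assoc, hvy, hux, one_mul, sub_self]
    · rw [sub_mul', mul_assoc, hv z hz hzx, hu z hz hzx, one_mul, sub_self]
  have h1 : 1 + b = 1 := ha.eq_one_of_mul_eq ⟨⟨1 + b, 1 + c, huv, hvu⟩, rfl⟩ hw0 (hu w hw hwx)
  rw [h1, one_mul] at hux
  exact hux

/-- Elements of `N` interpolating arbitrary values at single points show that `L` has at most two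
non-zero elements. -/
theorem IsANearRing.not_three (ha : IsANearRing N) {L : AddSubgroup N}
    (h : IsFaithfulMinimal L)
    (hint : ∀ x ∈ L, x ≠ 0 → ∀ z ∈ L, ∃ b : N, b * x = z ∧ ∀ y ∈ L, y ≠ x → b * y = 0)
    {x y w : N} (hx : x ∈ L) (hx0 : x ≠ 0) (hy : y ∈ L) (hy0 : y ≠ 0) (hxy : x ≠ y)
    (hw : w ∈ L) (hw0 : w ≠ 0) : w = x ∨ w = y := by
  by_contra! hcon
  -- `1 + b + c` is the transposition of `x` and `y`: an involutive unit fixing the third point `w`.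
  obtain ⟨b, hb, hb0⟩ := hint x hx hx0 _ (L.add_mem (L.neg_mem hx) hy)
  obtain ⟨c, hc, hc0⟩ := hint y hy hy0 _ (L.add_mem (L.neg_mem hy) hx)
  have hux : (1 + b + c) * x = y := by
    rw [add_mul', add_mul', hb, hc0 x hx hxy, one_mul, add_neg_cancel_left, add_zero]
  have huy : (1 + b + c) * y = x := by
    rw [add_mul', add_mul', hc, hb0 y hy hxy.symm, one_mul, add_zero, add_neg_cancel_left]
  have hu : ∀ z ∈ L, z ≠ x → z ≠ y → (1 + b + c) * z = z := fun z hz hzx hzy => by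
    rw [add_mul', add_mul', hb0 z hz hzx, hc0 z hz hzy, one_mul, add_zero, add_zero]
  have huu : (1 + b + c) * (1 + b + c) = 1 := by
    refine h.ext fun z hz => ?_
    rw [mul_assoc, one_mul]
    by_cases hzx : z = x
    · rw [hzx, hux, huy]
    · by_cases hzy : z = y
      · rw [hzy, huy, hux]
      · rw [hu z hz hzx hzy, hu z hz hzx hzy]
  have h1 : 1 + b + c = 1 := ha.eq_one_of_mul_eq ⟨⟨_, _, huu, huu⟩, rfl⟩ hw0 (hu w hw hcon.1 hcon.2)
  rw [h1, one_mul] at hux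
  exact hxy hux

/-- If `N` acts on `L` by all maps fixing `0`, then `N ≅ M₀(Γ)` for each `Γ ≅ L`. -/
theorem IsFaithfulMinimal.nonempty_ringEquiv_M0 {L : AddSubgroup N} (h : IsFaithfulMinimal L)
    {Γ : Type*} [AddGroup Γ] (e : L ≃+ Γ)
    (hsurj : ∀ f : L → L, f 0 = 0 → ∃ n : N, ∀ x : L, n * (x : N) = f x) :
    Nonempty (N ≃+* M0 Γ) := by
  let φ : N → M0 Γ := fun n =>
    ⟨fun z => e ⟨n * (e.symm z : L), h.isNSubgroup n _ (e.symm z).2⟩, by simp⟩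
  have hφ : ∀ n z, (φ n).val z = e ⟨n * (e.symm z : L), h.isNSubgroup n _ (e.symm z).2⟩ :=
    fun _ _ => rfl
  have hbij : Function.Bijective φ := by
    constructor
    · refine fun a b hab => h.ext fun x hx => ?_
      have := congrArg (fun f => f.val (e ⟨x, hx⟩)) hab
      simpa [hφ] using this
    · intro f
      obtain ⟨n, hn⟩ := hsurj (fun x => e.symm (f.val (e x))) (by simp [f.property])
      refine ⟨n, M0.ext (funext fun z => ?_)⟩
      rw [hφ, ← e.symm.injective.eq_iff]
      ext
      simp [hn]
  refine ⟨{ Equiv.ofBijective φ hbij with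
    map_mul' := fun a b => M0.ext (funext fun z => ?_)
    map_add' := fun a b => M0.ext (funext fun z => ?_) }⟩
  · change (φ (a * b)).val z = (φ a).val ((φ b).val z)
    simp [hφ, mul_assoc]
  · change (φ (a + b)).val z = (φ a).val z + (φ b).val z
    rw [hφ, hφ, hφ, ← map_add]
    congr 1
    ext
    exact add_mul' a b _

/-- A simple a-near-ring with DCCN which is not a ring is a near-field or `M₀(ℤ₃)`. -/
theorem IsANearRing.isNearField_or_M0 (ha : IsANearRing N) (hs : IsSimple N) (hd : DCCN N)
    (hring : ¬ IsRing N) : IsNearField N ∨ Nonempty (N ≃+* M0 (ZMod 3)) := by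
  classical
  obtain ⟨L, h⟩ := exists_isFaithfulMinimal hs hd
  by_cases hsame : ∀ x ∈ L, x ≠ 0 → ∀ y ∈ L, y ≠ 0 → SameAnn x y
  · exact Or.inl (h.isNearField hs.1 hsame)
  right
  push Not at hsame
  obtain ⟨x, hx, hx0, y, hy, hy0, hxy⟩ := hsame
  have heq : ∀ u ∈ L, u ≠ 0 → ∀ v ∈ L, v ≠ 0 → SameAnn u v → u = v := by
    intro u hu hu0 v hv hv0 huv
    by_cases hxu : SameAnn x u
    · refine ha.eq_of_sameAnn h hring hd hu hu0 hv hv0 huv hy hy0 fun hyu => hxy ?_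
      exact fun n => (hxu n).trans (hyu n).symm
    · exact ha.eq_of_sameAnn h hring hd hu hu0 hv hv0 huv hx hx0 hxu
  have hint : ∀ x ∈ L, x ≠ 0 → ∀ z ∈ L, ∃ b : N, b * x = z ∧ ∀ y ∈ L, y ≠ x → b * y = 0 := by
    intro x hx hx0 z hz
    obtain ⟨b, hb, hb0⟩ := h.exists_mul_eq_and_mul_eq_zero hring hd hx hx0 hz
    refine ⟨b, hb, fun y hy hyx => ?_⟩
    rcases eq_or_ne y 0 with rfl | hy0
    · exact mul_zero b
    · exact hb0 y hy fun hs => hyx (heq y hy hy0 x hx hx0 hs)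
  have hne : x ≠ y := by rintro rfl; exact hxy fun _ => Iff.rfl
  have hall : ∀ w ∈ L, w = 0 ∨ w = x ∨ w = y := fun w hw => by
    by_cases hw0 : w = 0
    · exact Or.inl hw0
    · exact Or.inr (ha.not_three h hint hx hx0 hy hy0 hne hw hw0)
  have hcard : Nat.card L = 3 := by
    have hL : (L : Set N) = (({0, x, y} : Finset N) : Set N) := by
      ext w
      simp only [SetLike.mem_coe, Finset.coe_insert, Finset.coe_singleton, Set.mem_insert_iff,
        Set.mem_singleton_iff]
      refine ⟨hall w, ?_⟩
      rintro (rfl | rfl | rfl)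
      exacts [L.zero_mem, hx, hy]
    have h1 : Nat.card L = (L : Set N).ncard := rfl
    rw [h1, hL, Set.ncard_coe_finset]
    exact Finset.card_eq_three.2 ⟨0, x, y, hx0.symm, hy0.symm, hne, rfl⟩
  have : Fact (Nat.Prime 3) := ⟨Nat.prime_three⟩
  have : IsAddCyclic L := isAddCyclic_of_prime_card hcard
  have e : L ≃+ ZMod 3 := (hcard ▸ (zmodAddCyclicAddEquiv (G := L) inferInstance)).symm
  refine h.nonempty_ringEquiv_M0 e fun f hf => ?_
  obtain ⟨b, hb, hb0⟩ := hint x hx hx0 _ (f ⟨x, hx⟩).2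
  obtain ⟨c, hc, hc0⟩ := hint y hy hy0 _ (f ⟨y, hy⟩).2
  refine ⟨b + c, ?_⟩
  rintro ⟨w, hw⟩
  rcases hall w hw with rfl | rfl | rfl
  · have : f ⟨0, hw⟩ = 0 := hf
    rw [mul_zero, this, AddSubgroup.coe_zero]
  · rw [add_mul', hb, hc0 w hw hne, add_zero]
  · rw [add_mul', hc, hb0 w hw hne.symm, zero_add]

end ANearRing

end NearRing

theorem mainTheorem2 (N : Type u) [ZeroSymmNearRing N]
    (ha : NearRing.IsANearRing N) (hs : NearRing.IsSimple N) (hd : NearRing.DCCN N) :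
    (NearRing.IsRing N → ENat.card Nˣ = 1 →
      ∃ k : ℕ, 1 ≤ k ∧ Nonempty (N ≃+* (Fin k → ZMod 2))) ∧
    (NearRing.IsRing N → 2 ≤ ENat.card Nˣ → NearRing.IsDivisionRing N) ∧
    (¬ NearRing.IsRing N →
      NearRing.IsNearField N ∨ Nonempty (N ≃+* NearRing.M0 (ZMod 3))) := by
  -- All non-zero elements are units, so a single unit leaves only `0` and `1`, whence `k = 1`.
  refine ⟨fun hr hU => ⟨1, le_rfl, ?_⟩, fun hr _ => ?_, ha.isNearField_or_M0 hs hd⟩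
  · refine NearRing.nonempty_ringEquiv_zmod_two hs.1 fun a => ?_
    by_cases h0 : a = 0
    · exact Or.inl h0
    · obtain ⟨b, hab, hba⟩ := ha.exists_inv_of_isRing hs hd hr h0
      have : Subsingleton Nˣ := (ENat.card_le_one_iff_subsingleton _).1 hU.le
      exact Or.inr (congrArg Units.val (Subsingleton.elim (⟨a, b, hab, hba⟩ : Nˣ) 1))
  · exact NearRing.isDivisionRing_of_exists_inv hs.1 hr fun a h0 =>
      ha.exists_inv_of_isRing hs hd hr h0
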